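/- For a real Banach space $\mathfrak A$ of finite dimension $n$ with norm $|\cdot|_{\mathfrak A}$ and closed unit ball $K$, and a Borel probability measure $\nu$ on $\mathfrak A$ supported on $K$, let \[\Delta(\nu)=\int_{x\in K}\int_{y\in K}|x-y|_{\mathfrak A}\,\nu(x)\,\nu(y).\] For a centrally symmetric compact convex body $H\subset\mathbb R^n$ let $\Theta(H)$ be its translative covering density, that is, the infimum, over all sets $\Lambda\subset\mathbb R^n$ with $\bigcup_{t\in\Lambda}(t+H)=\mathbb R^n$, of the density \[\liminf_{R\to\infty}\frac{\#\{t\in\Lambda:(t+H)\cap B_R\neq\emptyset\}\cdot\mathrm{vol}(H)}{\mathrm{vol}(B_R)},\] where $B_R$ is the closed Euclidean ball of radius $R$ about the origin. Let \[\Theta_n=\inf_{0<\eta<1/n}(1+\eta)^n\bigl(1+n\log(1/\eta)\bigr)\] be Rogers' bound. (a) Let $n\ge 3$. Then $\Theta(H)\le\Theta_n$ for every centrally symmetric compact convex body $H\subset\mathbb R^n$ (with non-empty interior). Moreover, for every real Banach space of dimension $n$ and every Borel probability measure $\nu$ supported on its closed unit ball, \[\Delta(\nu)<2\left(1-2^{-n}\,\frac{2\left(1-\frac2n\right)}{\mathrm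 e\,n\,\Theta_n}\right),\] and the same inequality holds with $\Theta_n$ replaced by any real number $T$ such that $\Theta(H)\le T$ for all centrally symmetric compact convex bodies $H\subset\mathbb R^n$. (b) There is a function $f:\{2,3,4,\ldots\}\to(0,1]$ with $f(n)=\frac{2(1-2/n)}{\mathrm e\,n\,\Theta_n}$ for $n\ge3$ and $f(n)\sim\frac{2}{\mathrm e\,n^2\log n}$ as $n\to\infty$, such that $\Delta(\nu)\le 2\left(1-2^{-n}f(n)\right)$ for every $n\ge2$, every real Banach space of dimension $n$ and every Borel probability measure $\nu$ supported on its closed unit ball. -/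

import Mathlib

open MeasureTheory Set Filter
open scoped ENNReal Pointwise Asymptotics

noncomputable section

/-- The averaged self-distance `∫_{x ∈ K} ∫_{y ∈ K} |x - y| ν(x) ν(y)` of a measure, `K` being the
closed unit ball. -/
def avgSelfDist {E : Type*} [NormedAddCommGroup E] [MeasurableSpace E] (ν : Measure E) : ℝ :=
  ∫ x in Metric.closedBall (0 : E) 1, ∫ y in Metric.closedBall (0 : E) 1, ‖x - y‖ ∂ν ∂ν

/-- Centrally symmetric compact convex bodies (with non-empty interior) in `ℝⁿ`. -/
structure IsSymmConvexBody {n : ℕ} (H : Set (EuclideanSpace ℝ (Fin n))) : Prop where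
  convex : Convex ℝ H
  isCompact : IsCompact H
  interior_nonempty : (interior H).Nonempty
  neg_eq : -H = H

/-- The (lower) density of the family of translates `t + H`, `t ∈ Λ`: the lower limit, as `R → ∞`,
of the total volume of the translates that meet the ball of radius `R`, divided by the volume of
that ball. -/
def translateDensity {n : ℕ} (H Λ : Set (EuclideanSpace ℝ (Fin n))) : ℝ≥0∞ :=
  liminf (fun R : ℝ =>
    (({t ∈ Λ | ((t +ᵥ H) ∩ Metric.closedBall 0 R).Nonempty}.encard : ℕ∞) : ℝ≥0∞) * volume H /
      volume (Metric.closedBall (0 : EuclideanSpace ℝ (Fin n)) R)) atTop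

/-- The translative covering density `Θ(H)`: the infimum of the densities of the coverings of `ℝⁿ`
by translates of `H`. -/
def coveringDensity {n : ℕ} (H : Set (EuclideanSpace ℝ (Fin n))) : ℝ≥0∞ :=
  ⨅ (Λ : Set (EuclideanSpace ℝ (Fin n))) (_ : ⋃ t ∈ Λ, (t +ᵥ H) = univ), translateDensity H Λ

/-- `T` bounds the translative covering density of every centrally symmetric convex body
in `ℝⁿ`. -/
def IsUniversalCoveringBound (n : ℕ) (T : ℝ) : Prop :=
  ∀ H : Set (EuclideanSpace ℝ (Fin n)), IsSymmConvexBody H →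
    coveringDensity H ≤ ENNReal.ofReal T

/-- Rogers' bound `min_{0 < η < 1/n} (1 + η)^n (1 + n log (1/η))`, written as an infimum
(which is attained for `n ≥ 3`). -/
def rogersBound (n : ℕ) : ℝ :=
  sInf ((fun η : ℝ => (1 + η) ^ n * (1 + n * Real.log (1 / η))) '' Ioo (0 : ℝ) (1 / n))

end

/-! If the unit ball `K` is covered by `N` balls of radius `h < 1`, cut it into disjoint cells, one
inside each ball. Two points of one cell are at distance at most `2h`, any other two at most `2`. By
Cauchy-Schwarz the squared cell masses sum to at least `1/N`, so the average distance is at most `2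
- (2 - 2h)/N` (`avgSelfDist_le_of_subset_iUnion_closedBall`).

To make `N` small, take a covering of the whole space by translates of `hK` of density below `T`.
Some translate `x + (1 + h)K` contains at most about the average number of its centres, `T((1 +
h)/h)^n`, and these centres suffice to cover `x + K` (`exists_finset_cover_of_coveringDensity_lt`).
For `h = n/(n + 2)` this count is `T 2^n (1 + 1/n)^n`, which is below `2^n e T`.

Rogers' bound on `T` comes from covering a large cube in two stages
(`exists_finset_cover_halfOpenCube`). Greedily chosen translates of `K` leave a proportion at most
`η^n` uncovered; a maximal packing of translates of `ηK` fits into the remainder, and there is room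
for few of them. Enlarging all chosen translates to `(1 + η)K` covers the cube. Periodic repetition
(`coveringDensity_le_of_cover_halfOpenCube`) and growing cubes then give the density bound. -/

/-! ### Averaging over translates; volumes of balls -/

theorem mem_vadd_set_iff_sub_mem {G : Type*} [AddCommGroup G] {x a : G} {M : Set G} :
    x ∈ a +ᵥ M ↔ x - a ∈ M := by
  rw [mem_vadd_set_iff_neg_vadd_mem, vadd_eq_add, neg_add_eq_sub]

/-- By Tonelli, the integral of `|S ∩ (a + K)|` over `a ∈ A` is `|S||K|`: each `x ∈ S` is counted
for the `a` in `x - K`, a subset of `A` of volume `|K|`. Some `a` does at least as well as the mean.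
This is one greedy step. -/
theorem exists_volume_mul_le_volume_inter_vadd {n : ℕ} {A S K : Set (EuclideanSpace ℝ (Fin n))}
    (hA : MeasurableSet A) (hS : MeasurableSet S) (hK : MeasurableSet K)
    (hA0 : volume A ≠ 0) (hAtop : volume A ≠ ∞) (hStop : volume S ≠ ∞)
    (h : ∀ x ∈ S, ∀ k ∈ K, x - k ∈ A) :
    ∃ a ∈ A, volume S * volume K ≤ volume A * volume (S ∩ (a +ᵥ K)) := by
  have hint : ∫⁻ a in A, volume (S ∩ (a +ᵥ K)) = volume S * volume K := by
    have h1 : ∀ a, volume (S ∩ (a +ᵥ K)) = ∫⁻ x in S, K.indicator 1 (x - a) := by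
      intro a
      have h2 : (fun x => K.indicator (1 : EuclideanSpace ℝ (Fin n) → ℝ≥0∞) (x - a)) = (a +ᵥ K).indicator 1 := by
        ext x
        by_cases hx : x - a ∈ K
        · rw [indicator_of_mem hx, indicator_of_mem (mem_vadd_set_iff_sub_mem.2 hx)]; rfl
        · rw [indicator_of_notMem hx, indicator_of_notMem (fun h' => hx (mem_vadd_set_iff_sub_mem.1 h'))]
      rw [h2, lintegral_indicator_one (hK.const_vadd a), Measure.restrict_apply (hK.const_vadd a),
        inter_comm]
    simp_rw [h1]
    rw [lintegral_lintegral_swap]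
    · have h3 : ∀ x ∈ S, ∫⁻ a in A, K.indicator (1 : EuclideanSpace ℝ (Fin n) → ℝ≥0∞) (x - a) = volume K := by
        intro x hx
        have h4 : (fun a => K.indicator (1 : EuclideanSpace ℝ (Fin n) → ℝ≥0∞) (x - a)) =
            ((fun a => x - a) ⁻¹' K).indicator 1 := by
          ext a; rfl
        have h5 : MeasurableSet ((fun a => x - a) ⁻¹' K) := (measurable_const.sub measurable_id) hK
        rw [h4, lintegral_indicator_one h5, Measure.restrict_apply h5, inter_eq_left.2]
        · exact (Measure.measurePreserving_sub_left volume x).measure_preimage hK.nullMeasurableSet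
        · intro a ha
          have := h x hx _ ha
          simpa using this
      rw [setLIntegral_congr_fun hS h3, setLIntegral_const, mul_comm]
    · apply Measurable.aemeasurable
      exact (measurable_one.indicator hK).comp (measurable_snd.sub measurable_fst)
  have hfin : ∫⁻ a in A, volume (S ∩ (a +ᵥ K)) ≠ ∞ := by
    refine ((setLIntegral_mono' hA (g := fun _ => volume S)
      fun a _ => measure_mono inter_subset_left).trans_lt ?_).ne
    rw [setLIntegral_const]
    exact ENNReal.mul_lt_top hStop.lt_top hAtop.lt_top
  obtain ⟨a, ha, hle⟩ := exists_setLAverage_le hA0 hA.nullMeasurableSet hfin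
  refine ⟨a, ha, ?_⟩
  rw [setLAverage_eq, hint] at hle
  rw [mul_comm (volume A)]
  exact (ENNReal.div_le_iff hA0 hAtop).1 hle

/-- Average the count over `x ∈ B`: each `t` contributes at most the volume of the reflected
translate `t - C`. -/
theorem exists_card_mul_volume_le {n : ℕ} {B C : Set (EuclideanSpace ℝ (Fin n))}
    (F : Finset (EuclideanSpace ℝ (Fin n)))
    (hC : MeasurableSet C) (hB0 : volume B ≠ 0) (hBtop : volume B ≠ ∞)
    [DecidablePred (· ∈ C)] :
    ∃ x ∈ B, ((F.filter fun t => t - x ∈ C).card : ℝ≥0∞) * volume B ≤ F.card * volume C := by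
  have hm : ∀ t, MeasurableSet ((fun x => t - x) ⁻¹' C) := fun t =>
    (measurable_const.sub measurable_id) hC
  have heq : ∀ x, ((F.filter fun t => t - x ∈ C).card : ℝ≥0∞) =
      ∑ t ∈ F, ((fun x => t - x) ⁻¹' C).indicator 1 x := by
    intro x
    rw [Finset.card_filter, Nat.cast_sum]
    refine Finset.sum_congr rfl fun t _ => ?_
    by_cases hx : t - x ∈ C
    · rw [indicator_of_mem (show x ∈ (fun x => t - x) ⁻¹' C from hx)]; simp [hx]
    · rw [indicator_of_notMem (show x ∉ (fun x => t - x) ⁻¹' C from hx)]; simp [hx]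
  have hmeas : Measurable fun x => ((F.filter fun t => t - x ∈ C).card : ℝ≥0∞) := by
    simp_rw [heq]
    exact Finset.measurable_fun_sum _ fun t _ => measurable_one.indicator (hm t)
  obtain ⟨x, hx, hle⟩ := exists_le_setLAverage hB0 hBtop hmeas.aemeasurable
  refine ⟨x, hx, ?_⟩
  rw [setLAverage_eq, ENNReal.le_div_iff_mul_le (Or.inl hB0) (Or.inl hBtop)] at hle
  refine hle.trans ?_
  simp_rw [heq]
  rw [lintegral_finsetSum _ fun t _ => measurable_one.indicator (hm t), ← nsmul_eq_mul]
  refine Finset.sum_le_card_nsmul _ _ _ fun t _ => ?_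
  rw [lintegral_indicator_one (hm t)]
  refine (Measure.restrict_apply_le _ _).trans ?_
  exact ((Measure.measurePreserving_sub_left volume t).measure_preimage hC.nullMeasurableSet).le

theorem tendsto_volume_closedBall_add_div {n : ℕ} (c : ℝ) :
    Tendsto (fun R : ℝ => volume (Metric.closedBall (0 : EuclideanSpace ℝ (Fin n)) (R + c)) /
      volume (Metric.closedBall (0 : EuclideanSpace ℝ (Fin n)) R)) atTop (nhds 1) := by
  have h1 : Tendsto (fun R : ℝ => ENNReal.ofReal ((1 + c / R) ^ n)) atTop (nhds 1) := by
    have h2 : Tendsto (fun R : ℝ => (1 + c / R) ^ n) atTop (nhds ((1 + 0) ^ n)) :=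
      (tendsto_const_nhds.add (tendsto_const_nhds.div_atTop tendsto_id)).pow n
    simpa using ENNReal.tendsto_ofReal h2
  refine h1.congr' ?_
  filter_upwards [eventually_gt_atTop 0, eventually_gt_atTop (-c)] with R hR hRc
  have hb : volume (Metric.ball (0 : EuclideanSpace ℝ (Fin n)) 1) ≠ 0 :=
    (Metric.measure_ball_pos _ _ one_pos).ne'
  rw [Measure.addHaar_closedBall _ _ hR.le, Measure.addHaar_closedBall _ _ (by linarith),
    ENNReal.mul_div_mul_right _ _ hb measure_ball_lt_top.ne, ← ENNReal.ofReal_div_of_pos (by positivity),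
    ← div_pow, add_div, div_self hR.ne', finrank_euclideanSpace_fin]

/-! ### From coverings of the unit ball to the average distance -/

theorem avgSelfDist_le_of_subset_iUnion_closedBall {E : Type*} [NormedAddCommGroup E]
    [MeasurableSpace E] [BorelSpace E] (ν : Measure E)
    [IsProbabilityMeasure ν] (hν : ν (Metric.closedBall (0 : E) 1)ᶜ = 0) {N : ℕ} (c : Fin N → E)
    {h : ℝ} (hh : h ≤ 1) (hc : Metric.closedBall (0 : E) 1 ⊆ ⋃ i, Metric.closedBall (c i) h) :
    avgSelfDist ν ≤ 2 - (2 - 2 * h) / N := by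
  set K := Metric.closedBall (0 : E) 1 with hKdef
  have hKm : MeasurableSet K := Metric.isClosed_closedBall.measurableSet
  set A : Fin N → Set E := disjointed fun i => Metric.closedBall (c i) h with hA
  have hAm : ∀ i, MeasurableSet (A i) := fun i =>
    disjointedRec (fun _ _ ht => MeasurableSet.diff ht Metric.isClosed_closedBall.measurableSet)
      Metric.isClosed_closedBall.measurableSet
  have hAd : Pairwise (Function.onFun Disjoint A) := disjoint_disjointed _
  have hAU : K ⊆ ⋃ i, A i := by rw [hA, iUnion_disjointed]; exact hc
  have hAs : ∀ i, A i ⊆ Metric.closedBall (c i) h := fun i => disjointed_subset _ i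
  have hres : ν.restrict K = ν := Measure.restrict_eq_self_of_ae_mem (by
    rw [ae_iff]; exact hν)
  have hKae : ∀ᵐ x ∂ν, x ∈ K := by rw [ae_iff]; exact hν
  have hnorm : ∀ x ∈ K, ∀ y ∈ K, ‖x - y‖ ≤ 2 := by
    intro x hx y hy
    rw [hKdef, mem_closedBall_zero_iff] at hx hy
    linarith [norm_sub_le x y]
  have hind : ∀ i, Integrable ((A i).indicator (1 : E → ℝ)) ν := fun i =>
    (integrable_const (1 : ℝ)).indicator (hAm i)
  -- For `x` in a cell, the saving over the trivial bound `2` is at least `2 - 2h` times the mass of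
  -- that cell; integrating over `x` then yields the sum of squared masses.
  have hinner : ∀ x ∈ K, ∀ i, x ∈ A i → ∫ y, ‖x - y‖ ∂ν ≤ 2 - (2 - 2 * h) * ν.real (A i) := by
    intro x hx i hxi
    calc ∫ y, ‖x - y‖ ∂ν ≤ ∫ y, (2 - (2 - 2 * h) * (A i).indicator 1 y) ∂ν := by
          refine integral_mono_of_nonneg (Eventually.of_forall fun y => norm_nonneg _)
            ((integrable_const _).sub ((hind i).const_mul _)) ?_
          filter_upwards [hKae] with y hy
          by_cases hyi : y ∈ A i
          · rw [indicator_of_mem hyi, Pi.one_apply]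
            have h1 := hAs i hxi
            have h2 := hAs i hyi
            rw [← dist_eq_norm]
            linarith [dist_triangle_right x y (c i), Metric.mem_closedBall.1 h1,
              Metric.mem_closedBall.1 h2]
          · rw [indicator_of_notMem hyi]
            linarith [hnorm x hx y hy]
      _ = _ := by
          rw [integral_sub (integrable_const _) ((hind i).const_mul _), integral_const_mul,
            integral_indicator_one (hAm i)]
          simp
  have hsum1 : ∑ i, ν.real (A i) = 1 := by
    rw [← measureReal_iUnion_fintype hAd hAm]
    refine le_antisymm measureReal_le_one ?_
    have : ν.real K = 1 := by
      rw [measureReal_def, (prob_compl_eq_zero_iff hKm).1 hν, ENNReal.toReal_one]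
    rw [← this]
    exact measureReal_mono hAU
  -- Cauchy-Schwarz: `N` masses with sum `1`.
  have hcs : 1 ≤ (N : ℝ) * ∑ i, ν.real (A i) ^ 2 := by
    have := sq_sum_le_card_mul_sum_sq (s := Finset.univ) (f := fun i => ν.real (A i))
    rw [hsum1] at this
    simpa using this
  have hN : (0 : ℝ) < N := by
    rcases Nat.eq_zero_or_pos N with h0 | h0
    · subst h0; simp at hcs; linarith
    · exact_mod_cast h0
  have houter : avgSelfDist ν ≤ 2 - (2 - 2 * h) * ∑ i, ν.real (A i) ^ 2 := by
    unfold avgSelfDist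
    rw [← hKdef, hres]
    have hint : Integrable (fun x => ∑ i, ν.real (A i) * (A i).indicator (1 : E → ℝ) x) ν :=
      integrable_finsetSum _ fun i _ => (hind i).const_mul _
    calc ∫ x, ∫ y, ‖x - y‖ ∂ν ∂ν
        ≤ ∫ x, (2 - (2 - 2 * h) * ∑ i, ν.real (A i) * (A i).indicator 1 x) ∂ν := by
          refine integral_mono_of_nonneg
            (Eventually.of_forall fun x => integral_nonneg fun y => norm_nonneg _)
            ((integrable_const _).sub (hint.const_mul _)) ?_
          filter_upwards [hKae] with x hx
          obtain ⟨i, hi⟩ := mem_iUnion.1 (hAU hx)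
          have hs : ∑ j, ν.real (A j) * (A j).indicator (1 : E → ℝ) x = ν.real (A i) := by
            rw [Finset.sum_eq_single i]
            · simp [indicator_of_mem hi]
            · intro j _ hj
              rw [indicator_of_notMem, mul_zero]
              exact fun hxj => (hAd hj).le_bot ⟨hxj, hi⟩
            · simp
          rw [hs]
          exact hinner x hx i hi
      _ = _ := by
          rw [integral_sub (integrable_const _) (hint.const_mul _), integral_const_mul,
            integral_finsetSum _ fun i _ => (hind i).const_mul _]
          simp_rw [integral_const_mul, integral_indicator_one (hAm _), pow_two]
          simp
  have : (2 - 2 * h) / N ≤ (2 - 2 * h) * ∑ i, ν.real (A i) ^ 2 := by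
    rw [div_eq_mul_inv]
    refine mul_le_mul_of_nonneg_left ?_ (by linarith)
    rw [inv_le_iff_one_le_mul₀' hN]
    exact hcs
  linarith

/-! ### Symmetric convex bodies and finite coverings extracted from a density -/

namespace IsSymmConvexBody

variable {n : ℕ} {K : Set (EuclideanSpace ℝ (Fin n))}

theorem smul (hK : IsSymmConvexBody K) {r : ℝ} (hr : r ≠ 0) : IsSymmConvexBody (r • K) where
  convex := hK.convex.smul r
  isCompact := hK.isCompact.smul r
  interior_nonempty := by
    rw [interior_smul₀ hr]
    exact hK.interior_nonempty.smul_set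
  neg_eq := by rw [← smul_set_neg, hK.neg_eq]

theorem neg_mem (hK : IsSymmConvexBody K) {x : EuclideanSpace ℝ (Fin n)} (hx : x ∈ K) :
    -x ∈ K := by
  rw [← hK.neg_eq]; simpa using hx

theorem zero_mem (hK : IsSymmConvexBody K) : (0 : EuclideanSpace ℝ (Fin n)) ∈ K := by
  obtain ⟨x, hx⟩ := hK.interior_nonempty
  have := hK.convex (interior_subset hx) (hK.neg_mem (interior_subset hx))
    (by norm_num : (0 : ℝ) ≤ 1 / 2) (by norm_num : (0 : ℝ) ≤ 1 / 2) (by norm_num)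
  simpa using this

theorem volume_ne_zero (hK : IsSymmConvexBody K) : volume K ≠ 0 :=
  (Measure.measure_pos_of_nonempty_interior _ hK.interior_nonempty).ne'

theorem volume_ne_top (hK : IsSymmConvexBody K) : volume K ≠ ∞ := hK.isCompact.measure_lt_top.ne

theorem measurableSet (hK : IsSymmConvexBody K) : MeasurableSet K := hK.isCompact.measurableSet

theorem sub_mem_smul (hK : IsSymmConvexBody K) {p q : ℝ} (hp : 0 ≤ p) (hq : 0 ≤ q)
    {x y : EuclideanSpace ℝ (Fin n)} (hx : x ∈ p • K) (hy : y ∈ q • K) : x - y ∈ (p + q) • K := by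
  rw [hK.convex.add_smul hp hq, sub_eq_add_neg]
  refine add_mem_add hx ?_
  obtain ⟨z, hz, rfl⟩ := hy
  exact ⟨-z, hK.neg_mem hz, smul_neg _ _⟩

end IsSymmConvexBody

theorem volume_smul_of_pos {n : ℕ} {r : ℝ} (hr : 0 < r) (K : Set (EuclideanSpace ℝ (Fin n))) :
    volume (r • K) = ENNReal.ofReal (r ^ n) * volume K := by
  rw [Measure.addHaar_smul, finrank_euclideanSpace_fin, abs_of_pos (by positivity)]

/-- A translate `t + hK` meeting `x + K` has its centre in `x + (1 + h)K`. Averaging over `x` in a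
large ball finds an `x` for which the number of such centres is at most the density times `|(1 +
h)K| / |hK|`, up to a boundary factor. -/
theorem exists_finset_cover_of_coveringDensity_lt {n : ℕ} {K : Set (EuclideanSpace ℝ (Fin n))}
    (hK : IsSymmConvexBody K) {h : ℝ} (hh : 0 < h) {T : ℝ≥0∞}
    (hT : coveringDensity (h • K) < T) :
    ∃ F : Finset (EuclideanSpace ℝ (Fin n)), K ⊆ ⋃ t ∈ F, (t +ᵥ h • K) ∧
      (F.card : ℝ≥0∞) * ENNReal.ofReal (h ^ n) ≤ T * ENNReal.ofReal ((1 + h) ^ n) := by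
  classical
  have hD : IsSymmConvexBody (h • K) := hK.smul hh.ne'
  obtain ⟨T₁, hT₁, hT₁T⟩ := exists_between hT
  simp only [coveringDensity, iInf_lt_iff] at hT₁
  obtain ⟨Λ, hΛ, hlim⟩ := hT₁
  obtain ⟨c, hc⟩ := hK.isCompact.isBounded.exists_norm_le
  have hfreq := frequently_lt_of_liminf_lt (by isBoundedDefault) hlim
  -- The gap between `T₁` and `T` absorbs the loss from shrinking the radius `R` to `R - c`.
  have hev : ∀ᶠ R : ℝ in atTop,
      T₁ * (volume (Metric.closedBall (0 : EuclideanSpace ℝ (Fin n)) R) /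
        volume (Metric.closedBall (0 : EuclideanSpace ℝ (Fin n)) (R - c))) < T := by
    have h1 := (tendsto_volume_closedBall_add_div (n := n) c).comp
      (tendsto_atTop_add_const_right atTop (-c) tendsto_id)
    have h2 := ENNReal.Tendsto.const_mul (a := T₁) h1 (Or.inl one_ne_zero)
    rw [mul_one] at h2
    filter_upwards [h2.eventually_lt_const hT₁T] with R hR
    simpa [sub_eq_add_neg] using hR
  obtain ⟨R, ⟨hRlt, hRev⟩, hR0, hRc⟩ :=
    ((hfreq.and_eventually hev).and_eventually
      ((eventually_gt_atTop 0).and (eventually_gt_atTop c))).exists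
  have hball : ∀ r : ℝ, 0 < r →
      volume (Metric.closedBall (0 : EuclideanSpace ℝ (Fin n)) r) ≠ 0 := fun r hr =>
    (Metric.measure_closedBall_pos _ _ hr).ne'
  have hballtop : ∀ r : ℝ, volume (Metric.closedBall (0 : EuclideanSpace ℝ (Fin n)) r) ≠ ∞ :=
    fun r => measure_closedBall_lt_top.ne
  rw [ENNReal.div_lt_iff (Or.inl (hball R hR0)) (Or.inl (hballtop R))] at hRlt
  rw [← mul_div_assoc, ENNReal.div_lt_iff (Or.inl (hball _ (by linarith))) (Or.inl (hballtop _))]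
    at hRev
  set G := {t ∈ Λ | ((t +ᵥ h • K) ∩ Metric.closedBall 0 R).Nonempty} with hG
  -- Infinitely many translates meeting the ball would make the density quotient infinite.
  have hGfin : G.Finite := by
    by_contra hinf
    rw [Set.Infinite.encard_eq hinf, ENat.toENNReal_top, ENNReal.top_mul hD.volume_ne_zero] at hRlt
    exact not_top_lt hRlt
  rw [hGfin.encard_eq_coe_toFinset_card, ENat.toENNReal_coe] at hRlt
  obtain ⟨x, hx, hle⟩ := exists_card_mul_volume_le hGfin.toFinset
    (hK.smul (by positivity : (1 + h) ≠ 0)).measurableSet (hball (R - c) (by linarith))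
    (hballtop (R - c))
  set F' := hGfin.toFinset.filter fun t => t - x ∈ (1 + h) • K with hF'
  refine ⟨F'.image fun t => t - x, ?_, ?_⟩
  · intro k hk
    have hmem : x + k ∈ ⋃ t ∈ Λ, (t +ᵥ h • K) := by rw [hΛ]; trivial
    simp only [mem_iUnion] at hmem
    obtain ⟨t, ht, htk⟩ := hmem
    have htk' : x + k - t ∈ h • K := by
      rwa [mem_vadd_set_iff_sub_mem] at htk
    -- As `x` lies in the ball of radius `R - c`, all of `x + K` stays in the ball of radius `R`, so
    -- the translate is counted.
    have htG : t ∈ G := by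
      refine ⟨ht, x + k, htk, ?_⟩
      rw [mem_closedBall_zero_iff] at hx ⊢
      linarith [norm_add_le x k, hc k hk]
    have htF : t ∈ F' := by
      rw [hF', Finset.mem_filter, Set.Finite.mem_toFinset]
      refine ⟨htG, ?_⟩
      have := hK.sub_mem_smul zero_le_one hh.le (by rwa [one_smul]) htk' (x := k)
      convert this using 1
      abel
    simp only [mem_iUnion]
    refine ⟨t - x, Finset.mem_image_of_mem _ htF, ?_⟩
    rw [mem_vadd_set_iff_neg_vadd_mem, vadd_eq_add]
    convert htk' using 1
    abel
  · have hcard : ((F'.image fun t => t - x).card : ℝ≥0∞) ≤ F'.card := by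
      exact_mod_cast Finset.card_image_le
    refine (mul_le_mul_left hcard _).trans ?_
    rw [volume_smul_of_pos (by positivity)] at hle
    rw [volume_smul_of_pos hh] at hRlt
    set b := volume (Metric.closedBall (0 : EuclideanSpace ℝ (Fin n)) (R - c)) with hb
    have hb0 : b ≠ 0 := hball _ (by linarith)
    have hbtop : b ≠ ∞ := hballtop _
    have hv0 := hK.volume_ne_zero
    have hvtop := hK.volume_ne_top
    have key : (F'.card : ℝ≥0∞) * ENNReal.ofReal (h ^ n) * (b * volume K) ≤
        T * ENNReal.ofReal ((1 + h) ^ n) * (b * volume K) :=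
      calc (F'.card : ℝ≥0∞) * ENNReal.ofReal (h ^ n) * (b * volume K)
          = (F'.card * b) * (ENNReal.ofReal (h ^ n) * volume K) := by ring
        _ ≤ (hGfin.toFinset.card * (ENNReal.ofReal ((1 + h) ^ n) * volume K)) *
            (ENNReal.ofReal (h ^ n) * volume K) := by gcongr
        _ = (hGfin.toFinset.card * (ENNReal.ofReal (h ^ n) * volume K)) *
            (ENNReal.ofReal ((1 + h) ^ n) * volume K) := by ring
        _ ≤ (T * b) * (ENNReal.ofReal ((1 + h) ^ n) * volume K) := by
            exact mul_le_mul' (hRlt.trans hRev).le le_rfl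
        _ = _ := by ring
    exact (ENNReal.mul_le_mul_iff_left (mul_ne_zero hb0 hv0) (ENNReal.mul_ne_top hbtop hvtop)).1 key

/-! ### The distance estimate from a universal covering bound -/

theorem avgSelfDist_lt_of_isUniversalCoveringBound {n : ℕ} (hn : 1 ≤ n) {T : ℝ}
    (hT : IsUniversalCoveringBound n T) {E : Type*} [NormedAddCommGroup E] [NormedSpace ℝ E]
    [MeasurableSpace E] [BorelSpace E] (ν : Measure E) [IsProbabilityMeasure ν]
    (hE : Module.finrank ℝ E = n) (hν : ν (Metric.closedBall (0 : E) 1)ᶜ = 0) :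
    0 < T ∧ avgSelfDist ν < 2 * (1 - (2 : ℝ)⁻¹ ^ n * (2 / (Real.exp 1 * (n + 2) * T))) := by
  have hn0 : (0 : ℝ) < n := by exact_mod_cast hn
  have : FiniteDimensional ℝ E := Module.finite_of_finrank_pos (by omega)
  let e : E ≃L[ℝ] EuclideanSpace ℝ (Fin n) :=
    ContinuousLinearEquiv.ofFinrankEq (by rw [hE, finrank_euclideanSpace_fin])
  have : ProperSpace E := FiniteDimensional.proper ℝ E
  have hK : IsSymmConvexBody (e '' Metric.closedBall (0 : E) 1) :=
    { convex := (convex_closedBall _ _).linear_image e.toLinearEquiv.toLinearMap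
      isCompact := (isCompact_closedBall _ _).image e.continuous
      interior_nonempty := by
        have h1 : (interior (Metric.closedBall (0 : E) 1)).Nonempty :=
          ⟨0, Metric.ball_subset_interior_closedBall (Metric.mem_ball_self one_pos)⟩
        have h2 := e.toHomeomorph.image_interior (Metric.closedBall (0 : E) 1)
        change e '' _ = interior (e '' _) at h2
        rw [← h2]
        exact h1.image _
      neg_eq := by
        rw [← image_neg_of_apply_neg_eq_neg fun x _ => (map_neg e x), neg_closedBall, neg_zero] }
  -- Chosen so that `(1 + h)/h = 2(1 + 1/n)`, whose `n`-th power is below `2^n e`, while `2 - 2h =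
  -- 4/(n + 2)`.
  set h : ℝ := n / (n + 2) with hh
  have hh0 : 0 < h := by positivity
  have hh1 : h ≤ 1 := by rw [hh, div_le_one (by positivity)]; linarith
  have key : ∀ S : ℝ, 0 < S → T < S → ∃ N : ℕ, 0 < N ∧ (N : ℝ) ≤ S * (2 * (1 + 1 / n)) ^ n ∧
      avgSelfDist ν ≤ 2 - (2 - 2 * h) / N := by
    intro S hS hTS
    obtain ⟨F, hF, hcard⟩ := exists_finset_cover_of_coveringDensity_lt hK hh0
      ((hT _ (hK.smul hh0.ne')).trans_lt ((ENNReal.ofReal_lt_ofReal_iff hS).2 hTS))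
    refine ⟨F.card, ?_, ?_, ?_⟩
    · rw [Finset.card_pos]
      have h0 := hF hK.zero_mem
      simp only [mem_iUnion] at h0
      obtain ⟨t, ht, -⟩ := h0
      exact ⟨t, ht⟩
    · rw [← ENNReal.ofReal_natCast, ← ENNReal.ofReal_mul (by positivity),
        ← ENNReal.ofReal_mul hS.le, ENNReal.ofReal_le_ofReal_iff (by positivity)] at hcard
      rw [← le_div_iff₀ (by positivity), mul_div_assoc, ← div_pow] at hcard
      have hr : (1 + h) / h = 2 * (1 + 1 / n) := by rw [hh]; field_simp; ring
      rwa [hr] at hcard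
    · refine avgSelfDist_le_of_subset_iUnion_closedBall ν hν
        (fun i => e.symm (F.equivFin.symm i)) hh1 fun x hx => ?_
      have h0 := hF (mem_image_of_mem e hx)
      simp only [mem_iUnion] at h0
      obtain ⟨t, ht, y, ⟨z, ⟨w, hw, rfl⟩, rfl⟩, hy⟩ := h0
      refine mem_iUnion.2 ⟨F.equivFin ⟨t, ht⟩, ?_⟩
      have hx' : x = e.symm t + h • w := by
        apply e.injective
        simp only [map_add, map_smul, e.apply_symm_apply]
        exact hy.symm
      rw [mem_closedBall_zero_iff] at hw
      simp only [Equiv.symm_apply_apply, Metric.mem_closedBall, hx', dist_eq_norm,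
        add_sub_cancel_left, norm_smul, Real.norm_eq_abs, abs_of_pos hh0]
      nlinarith
  -- For `T ≤ 0` a small positive `S` would be admissible and force `N ≤ 1/2`.
  have hT0 : 0 < T := by
    by_contra hneg
    push Not at hneg
    have hC : 0 < (2 * (1 + 1 / (n : ℝ))) ^ n := by positivity
    obtain ⟨N, hN, hNle, -⟩ := key (1 / 2 / (2 * (1 + 1 / (n : ℝ))) ^ n) (by positivity)
      (hneg.trans_lt (by positivity))
    rw [div_mul_cancel₀ _ hC.ne'] at hNle
    have : (1 : ℝ) ≤ N := by exact_mod_cast hN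
    linarith
  refine ⟨hT0, ?_⟩
  have he : (1 + 1 / (n : ℝ)) ^ n < Real.exp 1 := by
    have h1 : 1 + 1 / (n : ℝ) < Real.exp (1 / n) := by
      have := Real.add_one_lt_exp (x := 1 / (n : ℝ)) (by positivity)
      linarith
    calc (1 + 1 / (n : ℝ)) ^ n < Real.exp (1 / n) ^ n :=
          pow_lt_pow_left₀ h1 (by positivity) (by omega)
      _ = Real.exp 1 := by
          rw [← Real.exp_nat_mul]; congr 1; field_simp
  set q := (1 + 1 / (n : ℝ)) ^ n with hq
  have hq0 : 0 < q := by positivity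
  -- The strict inequality `(1 + 1/n)^n < e` leaves room for `S > T`, needed because the infimum
  -- defining the density may not be attained.
  obtain ⟨S, hTS, hSlt⟩ : ∃ S, T < S ∧ S < T * Real.exp 1 / q := by
    apply exists_between
    rw [lt_div_iff₀ hq0]
    exact mul_lt_mul_of_pos_left he hT0
  obtain ⟨N, hN, hNle, hav⟩ := key S (hT0.trans hTS) hTS
  have hN0 : (0 : ℝ) < N := by exact_mod_cast hN
  have hNlt : (N : ℝ) < 2 ^ n * (T * Real.exp 1) := by
    rw [mul_pow, ← hq] at hNle
    rw [lt_div_iff₀ hq0] at hSlt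
    calc (N : ℝ) ≤ 2 ^ n * (S * q) := by linarith
      _ < _ := by gcongr
  refine hav.trans_lt ?_
  have h2 : 2 - 2 * h = 4 / (n + 2) := by rw [hh]; field_simp; ring
  have h3 : 2 * ((2 : ℝ)⁻¹ ^ n * (2 / (Real.exp 1 * (n + 2) * T))) =
      (4 / (n + 2)) / (2 ^ n * (T * Real.exp 1)) := by
    rw [inv_pow]; field_simp; norm_num
  have h4 : (4 / ((n : ℝ) + 2)) / (2 ^ n * (T * Real.exp 1)) < (4 / (n + 2)) / N := by
    gcongr
  rw [mul_sub, h3, h2]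
  linarith

/-! ### Rogers' covering theorem -/

/-- The half-open cube `[-s, s)ⁿ`. -/
def halfOpenCube (n : ℕ) (s : ℝ) : Set (EuclideanSpace ℝ (Fin n)) :=
  {x | ∀ i, x i ∈ Ico (-s) s}

theorem halfOpenCube_eq_preimage (n : ℕ) (s : ℝ) :
    halfOpenCube n s = WithLp.ofLp ⁻¹' (univ.pi fun _ : Fin n => Ico (-s) s) := by
  ext x; simp [halfOpenCube]

theorem measurableSet_halfOpenCube (n : ℕ) (s : ℝ) : MeasurableSet (halfOpenCube n s) := by
  rw [halfOpenCube_eq_preimage]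
  exact (PiLp.volume_preserving_ofLp (Fin n)).measurable
    (MeasurableSet.univ_pi fun _ => measurableSet_Ico)

theorem volume_halfOpenCube {n : ℕ} {s : ℝ} (hs : 0 ≤ s) :
    volume (halfOpenCube n s) = ENNReal.ofReal ((2 * s) ^ n) := by
  rw [halfOpenCube_eq_preimage, (PiLp.volume_preserving_ofLp (Fin n)).measure_preimage
    (MeasurableSet.univ_pi fun _ => measurableSet_Ico).nullMeasurableSet, volume_pi_pi]
  simp only [Real.volume_Ico, Finset.prod_const, Finset.card_univ, Fintype.card_fin]
  rw [← ENNReal.ofReal_pow (by linarith)]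
  congr 2; ring

theorem add_mem_halfOpenCube {n : ℕ} {s c : ℝ} {x y : EuclideanSpace ℝ (Fin n)}
    (hx : x ∈ halfOpenCube n s) (hy : ‖y‖ ≤ c) : x + y ∈ halfOpenCube n (s + c) := by
  intro i
  have h1 := hx i
  have h2 := abs_le.1 ((PiLp.norm_apply_le y i).trans hy)
  rw [PiLp.add_apply]
  exact ⟨by linarith [h1.1], by linarith [h1.2]⟩

theorem norm_le_of_mem_halfOpenCube {n : ℕ} {s : ℝ} {x : EuclideanSpace ℝ (Fin n)}
    (hx : x ∈ halfOpenCube n s) : ‖x‖ ≤ n * s := by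
  calc ‖x‖ ≤ ∑ i, ‖x i‖ := by
        rw [EuclideanSpace.norm_eq]
        refine Real.sqrt_le_iff.2 ⟨Finset.sum_nonneg fun _ _ => norm_nonneg _, ?_⟩
        exact Finset.sum_sq_le_sq_sum_of_nonneg fun _ _ => norm_nonneg _
    _ ≤ ∑ _i : Fin n, s :=
        Finset.sum_le_sum fun i _ => abs_le.2 ⟨(hx i).1, (hx i).2.le⟩
    _ = n * s := by simp

/-- Each greedy translate removes at least the proportion `p = |K|/|A|` of what is left, and `1 - p
≤ exp (-p)`. -/
theorem exists_finset_card_le_measureReal_sdiff_le {n : ℕ}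
    {A S K : Set (EuclideanSpace ℝ (Fin n))}
    (hA : MeasurableSet A) (hS : MeasurableSet S) (hK : MeasurableSet K)
    (hA0 : volume A ≠ 0) (hAtop : volume A ≠ ∞) (hStop : volume S ≠ ∞)
    (h : ∀ x ∈ S, ∀ k ∈ K, x - k ∈ A) (N : ℕ) :
    ∃ F : Finset (EuclideanSpace ℝ (Fin n)), F.card ≤ N ∧
      volume.real (S \ ⋃ a ∈ F, (a +ᵥ K)) ≤
        volume.real S * Real.exp (-(N * (volume.real K / volume.real A))) := by
  classical
  induction N with
  | zero => exact ⟨∅, by simp⟩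
  | succ N ih =>
    obtain ⟨F, hF, hle⟩ := ih
    set S' := S \ ⋃ a ∈ F, (a +ᵥ K) with hS'
    have hS'm : MeasurableSet S' :=
      hS.diff (Finset.measurableSet_biUnion _ fun a _ => hK.const_vadd a)
    have hS'top : volume S' ≠ ∞ := measure_ne_top_of_subset sdiff_subset hStop
    obtain ⟨a, -, ha⟩ := exists_volume_mul_le_volume_inter_vadd hA hS'm hK hA0 hAtop hS'top
      fun x hx => h x hx.1
    refine ⟨insert a F, (Finset.card_insert_le _ _).trans (by omega), ?_⟩
    have heq : S \ ⋃ b ∈ insert a F, (b +ᵥ K) = S' \ (a +ᵥ K) := by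
      rw [Finset.set_biUnion_insert, hS', sdiff_sdiff, union_comm]
    rw [heq]
    have hAr : 0 < volume.real A := ENNReal.toReal_pos hA0 hAtop
    have ha' : volume.real S' * volume.real K ≤ volume.real A * volume.real (S' ∩ (a +ᵥ K)) := by
      simp only [measureReal_def, ← ENNReal.toReal_mul]
      exact ENNReal.toReal_mono
        (ENNReal.mul_ne_top hAtop (measure_ne_top_of_subset inter_subset_left hS'top)) ha
    have hsum := measureReal_inter_add_sdiff (μ := volume) (s := S') (hK.const_vadd a) hS'top
    set p := volume.real K / volume.real A with hp
    have h1 : volume.real S' * p ≤ volume.real (S' ∩ (a +ᵥ K)) := by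
      rw [hp, ← mul_div_assoc, div_le_iff₀ hAr]; linarith
    calc volume.real (S' \ (a +ᵥ K)) ≤ volume.real S' * (1 - p) := by linarith
      _ ≤ volume.real S' * Real.exp (-p) := by
          gcongr
          linarith [Real.add_one_le_exp (-p)]
      _ ≤ volume.real S * Real.exp (-(N * p)) * Real.exp (-p) := by gcongr
      _ = _ := by
          rw [mul_assoc, ← Real.exp_add]
          congr 2; push_cast; ring

/-- Disjointness inside `S` bounds the size of a packing by volume, so one of maximal cardinality
exists; a translate missing all its members could be added. -/
theorem exists_finset_maximal_packing {n : ℕ} {S P : Set (EuclideanSpace ℝ (Fin n))}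
    (hP : MeasurableSet P) (hP0 : volume P ≠ 0) (hStop : volume S ≠ ∞) :
    ∃ G : Finset (EuclideanSpace ℝ (Fin n)), (G.card : ℝ≥0∞) * volume P ≤ volume S ∧
      ∀ x : EuclideanSpace ℝ (Fin n), x +ᵥ P ⊆ S → ∃ b ∈ G, ((x +ᵥ P) ∩ (b +ᵥ P)).Nonempty := by
  classical
  have hPne : P.Nonempty := nonempty_of_measure_ne_zero hP0
  let Good : Finset (EuclideanSpace ℝ (Fin n)) → Prop := fun G =>
    (∀ b ∈ G, b +ᵥ P ⊆ S) ∧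
      (G : Set (EuclideanSpace ℝ (Fin n))).PairwiseDisjoint fun b => b +ᵥ P
  have hcard : ∀ G, Good G → (G.card : ℝ≥0∞) * volume P ≤ volume S := by
    intro G hG
    calc (G.card : ℝ≥0∞) * volume P = volume (⋃ b ∈ G, (b +ᵥ P)) := by
          rw [measure_biUnion_finset hG.2 fun b _ => hP.const_vadd b]
          simp [measure_vadd]
      _ ≤ volume S := measure_mono (iUnion₂_subset hG.1)
  have hbdd : BddAbove {k | ∃ G, Good G ∧ G.card = k} := by
    obtain ⟨M, hM⟩ := ENNReal.exists_nat_gt (ENNReal.div_ne_top hStop hP0)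
    refine ⟨M, ?_⟩
    rintro k ⟨G, hG, rfl⟩
    have := (ENNReal.le_div_iff_mul_le (Or.inl hP0) (Or.inr hStop)).2 (hcard G hG)
    exact_mod_cast (this.trans_lt hM).le
  obtain ⟨G, hG, hGc⟩ := Nat.sSup_mem (s := {k | ∃ G, Good G ∧ G.card = k})
    ⟨0, ∅, by simp [Good], rfl⟩ hbdd
  refine ⟨G, hcard G hG, fun x hx => ?_⟩
  by_contra! hcon
  have hxG : x ∉ G := fun hxG => by
    have := hcon x hxG
    rw [inter_self] at this
    exact (hPne.vadd_set (a := x)).ne_empty this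
  have hGood : Good (insert x G) := by
    refine ⟨fun b hb => ?_, ?_⟩
    · rcases Finset.mem_insert.1 hb with rfl | hb
      · exact hx
      · exact hG.1 b hb
    · rw [Finset.coe_insert, pairwiseDisjoint_insert]
      exact ⟨hG.2, fun b hb _ => disjoint_iff_inter_eq_empty.2 (hcon b hb)⟩
  have := le_csSup hbdd ⟨insert x G, hGood, rfl⟩
  rw [Finset.card_insert_of_notMem hxG] at this
  omega

theorem exists_finset_cover_halfOpenCube {n : ℕ} {K : Set (EuclideanSpace ℝ (Fin n))}
    (hK : IsSymmConvexBody K) {c : ℝ} (hc : ∀ k ∈ K, ‖k‖ ≤ c) {s : ℝ} (hs : 0 < s)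
    {η : ℝ} (hη : η ∈ Ioo (0 : ℝ) 1) :
    ∃ F : Finset (EuclideanSpace ℝ (Fin n)),
      halfOpenCube n s ⊆ ⋃ t ∈ F, (t +ᵥ (1 + η) • K) ∧
      F.card * volume.real K ≤ n * Real.log (1 / η) * (2 * (s + c + c)) ^ n + volume.real K +
        (2 * (s + c)) ^ n := by
  classical
  obtain ⟨hη0, hη1⟩ := hη
  have hc0 : 0 ≤ c := (norm_nonneg _).trans (hc 0 hK.zero_mem)
  have hKr : 0 < volume.real K := ENNReal.toReal_pos hK.volume_ne_zero hK.volume_ne_top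
  have hvol : ∀ r : ℝ, 0 < r → volume.real (halfOpenCube n r) = (2 * r) ^ n := fun r hr => by
    rw [measureReal_def, volume_halfOpenCube hr.le, ENNReal.toReal_ofReal (by positivity)]
  have hvol0 : ∀ r : ℝ, 0 < r → volume (halfOpenCube n r) ≠ 0 := fun r hr => by
    rw [volume_halfOpenCube hr.le]
    exact (ENNReal.ofReal_pos.2 (by positivity)).ne'
  have hvoltop : ∀ r : ℝ, 0 < r → volume (halfOpenCube n r) ≠ ∞ := fun r hr => by
    rw [volume_halfOpenCube hr.le]; exact ENNReal.ofReal_ne_top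
  set V₂ := (2 * (s + c + c)) ^ n with hV₂
  have hV₂0 : 0 < V₂ := by positivity
  set L := n * Real.log (1 / η) with hL
  have hL0 : 0 ≤ L := mul_nonneg (Nat.cast_nonneg _) (Real.log_nonneg (by
    rw [le_div_iff₀ hη0]; linarith))
  -- Just enough greedy steps to leave a proportion at most `η^n`; the rounding costs the extra
  -- `volume.real K` in the bound.
  set N := ⌈L * V₂ / volume.real K⌉₊ with hN
  obtain ⟨F, hFN, hF⟩ := exists_finset_card_le_measureReal_sdiff_le
    (measurableSet_halfOpenCube n (s + c + c)) (measurableSet_halfOpenCube n (s + c))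
    hK.measurableSet (hvol0 _ (by linarith)) (hvoltop _ (by linarith)) (hvoltop _ (by linarith))
    (fun x hx k hk => by
      rw [sub_eq_add_neg]
      exact add_mem_halfOpenCube hx (by rw [norm_neg]; exact hc k hk)) N
  set U := halfOpenCube n (s + c) \ ⋃ a ∈ F, (a +ᵥ K) with hU
  have hUtop : volume U ≠ ∞ := measure_ne_top_of_subset sdiff_subset (hvoltop _ (by linarith))
  have hP := hK.smul hη0.ne'
  obtain ⟨G, hG, hGmax⟩ := exists_finset_maximal_packing hP.measurableSet hP.volume_ne_zero hUtop
  have hmono : ∀ p q : ℝ, 0 ≤ p → p ≤ q → p • K ⊆ q • K := by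
    intro p q hp hpq
    have h1 : q • K = p • K + (q - p) • K := by
      rw [← hK.convex.add_smul hp (by linarith)]; congr 1; ring
    rw [h1]
    exact fun y hy => ⟨y, hy, 0, ⟨0, hK.zero_mem, smul_zero _⟩, add_zero y⟩
  refine ⟨F ∪ G, ?_, ?_⟩
  · intro x hx
    simp only [mem_iUnion]
    by_cases hxU : x +ᵥ η • K ⊆ U
    -- If `x + ηK` is wholly uncovered it meets some `b + ηK`, so `x ∈ b + 2ηK`, and `2η ≤ 1 + η`.
    · obtain ⟨b, hb, y, hyx, hyb⟩ := hGmax x hxU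
      refine ⟨b, Finset.mem_union_right _ hb, ?_⟩
      rw [mem_vadd_set_iff_sub_mem] at hyx hyb ⊢
      have := hK.sub_mem_smul hη0.le hη0.le hyb hyx
      refine hmono (η + η) (1 + η) (by linarith) (by linarith) ?_
      convert this using 1
      abel
    -- Otherwise some `y ∈ x + ηK` is outside `U`. It is still in the cube widened by `c`, hence in
    -- a greedy translate `a + K`, and `x ∈ a + (1 + η)K`.
    · obtain ⟨y, hyx, hyU⟩ := not_subset.1 hxU
      have hyx' := mem_vadd_set_iff_sub_mem.1 hyx
      have hyc : y ∈ halfOpenCube n (s + c) := by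
        have h1 : y - x ∈ (1 : ℝ) • K := hmono η 1 hη0.le hη1.le hyx'
        rw [one_smul] at h1
        have := add_mem_halfOpenCube hx (hc _ h1)
        rwa [add_sub_cancel] at this
      have hyF : y ∈ ⋃ a ∈ F, (a +ᵥ K) := by
        by_contra hcon
        exact hyU ⟨hyc, hcon⟩
      simp only [mem_iUnion] at hyF
      obtain ⟨a, ha, hya⟩ := hyF
      refine ⟨a, Finset.mem_union_left _ ha, ?_⟩
      rw [mem_vadd_set_iff_sub_mem] at hya ⊢
      have := hK.sub_mem_smul zero_le_one hη0.le (by rwa [one_smul]) hyx' (x := y - a)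
      convert this using 1
      abel
  · have hGr : (G.card : ℝ) * (η ^ n * volume.real K) ≤ volume.real U := by
      rw [volume_smul_of_pos hη0] at hG
      have := ENNReal.toReal_mono hUtop hG
      rwa [ENNReal.toReal_mul, ENNReal.toReal_mul, ENNReal.toReal_natCast,
        ENNReal.toReal_ofReal (by positivity)] at this
    have hexp : Real.exp (-(N * (volume.real K / V₂))) ≤ η ^ n := by
      have h1 : L ≤ N * (volume.real K / V₂) := by
        have := Nat.le_ceil (L * V₂ / volume.real K)
        rw [← hN, div_le_iff₀ hKr] at this
        rw [← mul_div_assoc, le_div_iff₀ hV₂0]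
        exact this
      calc Real.exp (-(N * (volume.real K / V₂))) ≤ Real.exp (-L) := Real.exp_le_exp.2 (by linarith)
        _ = η ^ n := by
          rw [hL, one_div, Real.log_inv, mul_neg, neg_neg, Real.exp_nat_mul, Real.exp_log hη0]
    rw [hvol _ (by linarith), hvol _ (by linarith)] at hF
    -- The factor `η^n` in the uncovered volume cancels the one in the volume of `ηK`.
    have hG2 : (G.card : ℝ) * volume.real K ≤ (2 * (s + c)) ^ n := by
      have h1 : (G.card : ℝ) * volume.real K * η ^ n ≤ (2 * (s + c)) ^ n * η ^ n := by
        calc (G.card : ℝ) * volume.real K * η ^ n = G.card * (η ^ n * volume.real K) := by ring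
          _ ≤ _ := hGr
          _ ≤ _ := hF
          _ ≤ _ := by gcongr
      exact le_of_mul_le_mul_right h1 (by positivity)
    have hF2 : (F.card : ℝ) * volume.real K ≤ L * V₂ + volume.real K := by
      have h1 : (F.card : ℝ) ≤ L * V₂ / volume.real K + 1 := by
        have h2 : (F.card : ℝ) ≤ N := by exact_mod_cast hFN
        exact h2.trans (Nat.ceil_lt_add_one (by positivity)).le
      calc (F.card : ℝ) * volume.real K ≤ (L * V₂ / volume.real K + 1) * volume.real K := by gcongr
        _ = _ := by field_simp
    have hcard : ((F ∪ G).card : ℝ) ≤ F.card + G.card := by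
      exact_mod_cast Finset.card_union_le F G
    calc ((F ∪ G).card : ℝ) * volume.real K ≤ (F.card + G.card) * volume.real K := by gcongr
      _ ≤ _ := by linarith

/-- Repeat the finite covering along the lattice `2sℤ^n`, whose translates of the half-open cube
tile space. The density is then read off by counting cubes in a slightly larger ball. -/
theorem coveringDensity_le_of_cover_halfOpenCube {n : ℕ} {H : Set (EuclideanSpace ℝ (Fin n))}
    (hH : IsSymmConvexBody H) {s : ℝ} (hs : 0 < s) (F : Finset (EuclideanSpace ℝ (Fin n)))
    (hF : halfOpenCube n s ⊆ ⋃ t ∈ F, (t +ᵥ H)) :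
    coveringDensity H ≤ F.card * volume H / volume (halfOpenCube n s) := by
  classical
  set Q := halfOpenCube n s with hQ
  have hQ0 : volume Q ≠ 0 := by
    rw [hQ, volume_halfOpenCube hs.le]
    exact (ENNReal.ofReal_pos.2 (by positivity)).ne'
  have hQtop : volume Q ≠ ∞ := by
    rw [hQ, volume_halfOpenCube hs.le]; exact ENNReal.ofReal_ne_top
  have hQm : MeasurableSet Q := measurableSet_halfOpenCube n s
  let v : (Fin n → ℤ) → EuclideanSpace ℝ (Fin n) := fun z => WithLp.toLp 2 fun i => 2 * s * z i
  have hv : ∀ z i, v z i = 2 * s * z i := fun z i => rfl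
  have hdisj : Pairwise (Function.onFun Disjoint fun z => v z +ᵥ Q) := by
    intro z w hzw
    rw [Function.onFun, Set.disjoint_left]
    intro x hxz hxw
    apply hzw
    rw [mem_vadd_set_iff_sub_mem] at hxz hxw
    funext i
    have h1 := hxz i
    have h2 := hxw i
    rw [PiLp.sub_apply, hv] at h1 h2
    have h3 : ((z i : ℝ) - w i) < 1 := by
      by_contra! hcon
      nlinarith [h1.1, h2.2]
    have h4 : ((w i : ℝ) - z i) < 1 := by
      by_contra! hcon
      nlinarith [h1.2, h2.1]
    have h5 : z i - w i < 1 := by exact_mod_cast h3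
    have h6 : w i - z i < 1 := by exact_mod_cast h4
    omega
  have hcov : ∀ x : EuclideanSpace ℝ (Fin n), ∃ z, x ∈ v z +ᵥ Q := by
    intro x
    refine ⟨fun i => ⌊(x i + s) / (2 * s)⌋, mem_vadd_set_iff_sub_mem.2 fun i => ?_⟩
    rw [PiLp.sub_apply, hv]
    have h1 := Int.floor_le ((x i + s) / (2 * s))
    have h2 := Int.lt_floor_add_one ((x i + s) / (2 * s))
    rw [le_div_iff₀ (by positivity)] at h1
    rw [div_lt_iff₀ (by positivity)] at h2
    constructor <;> linarith
  obtain ⟨cH, hcH⟩ := hH.isCompact.isBounded.exists_norm_le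
  obtain ⟨cF, hcF⟩ := F.finite_toSet.isBounded.exists_norm_le
  -- If `t + v z + H` meets the ball of radius `R`, the whole cube `v z + Q` lies in the ball of
  -- radius `R + c`.
  set c := cF + cH + n * s with hc
  let Λ : Set (EuclideanSpace ℝ (Fin n)) :=
    (fun p : EuclideanSpace ℝ (Fin n) × (Fin n → ℤ) => p.1 + v p.2) '' ((F : Set _) ×ˢ univ)
  have hΛ : ⋃ t ∈ Λ, (t +ᵥ H) = univ := by
    refine eq_univ_of_forall fun x => ?_
    obtain ⟨z, hz⟩ := hcov x
    have h1 := hF (mem_vadd_set_iff_sub_mem.1 hz)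
    simp only [mem_iUnion] at h1 ⊢
    obtain ⟨t, ht, hxt⟩ := h1
    refine ⟨t + v z, ⟨(t, z), ⟨ht, trivial⟩, rfl⟩, ?_⟩
    rw [mem_vadd_set_iff_sub_mem] at hxt ⊢
    convert hxt using 1
    abel
  refine (iInf₂_le Λ hΛ).trans ?_
  have hbound : ∀ R : ℝ, 0 < R →
      (({t ∈ Λ | ((t +ᵥ H) ∩ Metric.closedBall 0 R).Nonempty}.encard : ℕ∞) : ℝ≥0∞) * volume H /
        volume (Metric.closedBall (0 : EuclideanSpace ℝ (Fin n)) R) ≤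
      F.card * volume H / volume Q *
        (volume (Metric.closedBall (0 : EuclideanSpace ℝ (Fin n)) (R + c)) /
          volume (Metric.closedBall (0 : EuclideanSpace ℝ (Fin n)) R)) := by
    intro R hR
    set Z := {z | v z +ᵥ Q ⊆ Metric.closedBall 0 (R + c)} with hZ
    have hsub : {t ∈ Λ | ((t +ᵥ H) ∩ Metric.closedBall 0 R).Nonempty} ⊆
        (fun p : EuclideanSpace ℝ (Fin n) × (Fin n → ℤ) => p.1 + v p.2) '' ((F : Set _) ×ˢ Z) := by
      rintro _ ⟨⟨⟨t, z⟩, ⟨ht, -⟩, rfl⟩, y, hy, hyR⟩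
      refine ⟨(t, z), ⟨ht, fun x hx => ?_⟩, rfl⟩
      rw [mem_vadd_set_iff_sub_mem] at hx hy
      have h1 := norm_le_of_mem_halfOpenCube hx
      have h2 := hcH _ hy
      have h3 := hcF _ ht
      rw [mem_closedBall_zero_iff] at hyR ⊢
      have h4 : x = (x - v z) + y - (y - (t + v z)) - t := by abel
      rw [h4]
      refine (norm_sub_le _ _).trans ?_
      have h5 := norm_sub_le ((x - v z) + y) (y - (t + v z))
      have h6 := norm_add_le (x - v z) y
      simp only at h2 h3 h5
      linarith
    have hZc : ((Z.encard : ℕ∞) : ℝ≥0∞) * volume Q ≤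
        volume (Metric.closedBall (0 : EuclideanSpace ℝ (Fin n)) (R + c)) := by
      rw [← ENNReal.tsum_set_const]
      calc ∑' _ : Z, volume Q = ∑' z : Z, volume (v z +ᵥ Q) := by simp [measure_vadd]
        _ = volume (⋃ z ∈ Z, (v z +ᵥ Q)) :=
            (measure_biUnion Z.to_countable (fun z _ w _ hzw => hdisj hzw)
              fun z _ => hQm.const_vadd _).symm
        _ ≤ _ := measure_mono (iUnion₂_subset fun z hz => hz)
    have hcard : (({t ∈ Λ | ((t +ᵥ H) ∩ Metric.closedBall 0 R).Nonempty}.encard : ℕ∞) : ℝ≥0∞) ≤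
        F.card * ((Z.encard : ℕ∞) : ℝ≥0∞) := by
      have h1 := (encard_le_encard hsub).trans (encard_image_le _ _)
      rw [encard_prod, encard_coe_eq_coe_finsetCard] at h1
      have h2 := ENat.toENNReal_le.2 h1
      rwa [ENat.toENNReal_mul, ENat.toENNReal_coe] at h2
    have hZc' := (ENNReal.le_div_iff_mul_le (Or.inl hQ0) (Or.inl hQtop)).2 hZc
    rw [← mul_div_assoc]
    refine ENNReal.div_le_div_right ?_ _
    calc _ ≤ F.card * (volume (Metric.closedBall (0 : EuclideanSpace ℝ (Fin n)) (R + c)) /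
          volume Q) * volume H :=
          mul_le_mul' (hcard.trans (mul_le_mul' le_rfl hZc')) le_rfl
      _ = _ := by simp only [div_eq_mul_inv]; ring
  have hlim := ENNReal.Tendsto.const_mul (a := (F.card : ℝ≥0∞) * volume H / volume Q)
    (tendsto_volume_closedBall_add_div (n := n) c) (Or.inl one_ne_zero)
  rw [mul_one] at hlim
  unfold translateDensity
  rw [← hlim.liminf_eq]
  exact liminf_le_liminf ((eventually_gt_atTop 0).mono hbound)

/-- Apply the cube covering to `K = (1 + η)⁻¹ H` and let the side grow: the boundary widening and
the rounding term vanish in the limit. -/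
theorem coveringDensity_le_rogers {n : ℕ} (hn : 1 ≤ n)
    {H : Set (EuclideanSpace ℝ (Fin n))} (hH : IsSymmConvexBody H) {η : ℝ} (hη : η ∈ Ioo (0 : ℝ) 1) :
    coveringDensity H ≤ ENNReal.ofReal ((1 + η) ^ n * (1 + n * Real.log (1 / η))) := by
  have hη0 := hη.1
  have hη' : (1 + η) ≠ 0 := by positivity
  have hK : IsSymmConvexBody ((1 + η)⁻¹ • H) := hH.smul (inv_ne_zero hη')
  set K := (1 + η)⁻¹ • H with hKdef
  have hHK : H = (1 + η) • K := by rw [hKdef, smul_inv_smul₀ hη']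
  obtain ⟨c, hc⟩ := hK.isCompact.isBounded.exists_norm_le
  set L := n * Real.log (1 / η) with hL
  have hbound : ∀ s : ℝ, 0 < s → coveringDensity H ≤ ENNReal.ofReal ((1 + η) ^ n *
      (L * (1 + (c + c) / s) ^ n + volume.real K / (2 * s) ^ n + (1 + c / s) ^ n)) := by
    intro s hs
    obtain ⟨F, hF, hcard⟩ := exists_finset_cover_halfOpenCube hK hc hs hη
    rw [← hHK] at hF
    refine (coveringDensity_le_of_cover_halfOpenCube hH hs F hF).trans ?_
    have hvol : volume H = ENNReal.ofReal ((1 + η) ^ n * volume.real K) := by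
      rw [congrArg volume hHK, volume_smul_of_pos (by linarith), ENNReal.ofReal_mul (by positivity),
        ofReal_measureReal hK.volume_ne_top]
    rw [hvol, volume_halfOpenCube hs.le, ← ENNReal.ofReal_natCast,
      ← ENNReal.ofReal_mul (Nat.cast_nonneg _),
      ← ENNReal.ofReal_div_of_pos (pow_pos (mul_pos two_pos hs) n)]
    refine ENNReal.ofReal_le_ofReal ?_
    have h1 : ∀ a : ℝ, (1 + a / s) ^ n = (2 * (s + a)) ^ n / (2 * s) ^ n := by
      intro a
      rw [← div_pow, mul_div_mul_left _ _ two_ne_zero, add_div, div_self hs.ne']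
    rw [h1, h1, div_le_iff₀ (by positivity)]
    calc (F.card : ℝ) * ((1 + η) ^ n * volume.real K)
        = (1 + η) ^ n * (F.card * volume.real K) := by ring
      _ ≤ (1 + η) ^ n * (L * (2 * (s + c + c)) ^ n + volume.real K + (2 * (s + c)) ^ n) := by
          gcongr
      _ = _ := by
          rw [← add_assoc s c c, mul_assoc ((1 + η) ^ n), ← mul_div_assoc, ← add_div, ← add_div,
            div_mul_cancel₀ _ (by positivity)]
  have hlim : Tendsto (fun s : ℝ => ENNReal.ofReal ((1 + η) ^ n *
      (L * (1 + (c + c) / s) ^ n + volume.real K / (2 * s) ^ n + (1 + c / s) ^ n))) atTop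
      (nhds (ENNReal.ofReal ((1 + η) ^ n * (1 + L)))) := by
    refine ENNReal.tendsto_ofReal (Tendsto.const_mul _ ?_)
    have h1 : ∀ a : ℝ, Tendsto (fun s : ℝ => (1 + a / s) ^ n) atTop (nhds 1) := by
      intro a
      have := (tendsto_const_nhds (x := (1 : ℝ)).add
        (tendsto_const_nhds.div_atTop tendsto_id (a := a))).pow n
      simpa using this
    have h2 : Tendsto (fun s : ℝ => volume.real K / (2 * s) ^ n) atTop (nhds 0) :=
      tendsto_const_nhds.div_atTop ((tendsto_pow_atTop (by omega)).comp
        (tendsto_id.const_mul_atTop two_pos))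
    have := (((h1 (c + c)).const_mul L).add h2).add (h1 c)
    convert this using 2
    ring
  exact ge_of_tendsto hlim ((eventually_gt_atTop 0).mono hbound)

/-! ### Size and asymptotics of Rogers' bound -/

theorem one_add_mul_log_le_rogersBound {n : ℕ} (hn : 1 ≤ n) :
    1 + n * Real.log n ≤ rogersBound n := by
  have hn0 : (0 : ℝ) < n := by exact_mod_cast hn
  refine le_csInf ((nonempty_Ioo.2 (by positivity)).image _) ?_
  rintro _ ⟨η, ⟨hη0, hη1⟩, rfl⟩
  have h1 : Real.log n ≤ Real.log (1 / η) := by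
    refine Real.log_le_log hn0 ?_
    rw [le_div_iff₀ hη0]
    rw [lt_div_iff₀ hn0] at hη1
    linarith
  have h2 : 0 ≤ Real.log n := Real.log_natCast_nonneg n
  have h3 : (1 : ℝ) ≤ (1 + η) ^ n := one_le_pow₀ (by linarith)
  have h4 : 1 + n * Real.log n ≤ 1 + n * Real.log (1 / η) := by gcongr
  have h5 : 0 ≤ n * Real.log n := by positivity
  change _ ≤ (1 + η) ^ n * (1 + n * Real.log (1 / η))
  nlinarith

theorem rogersBound_le {n : ℕ} {η : ℝ} (hη : η ∈ Ioo (0 : ℝ) (1 / n)) :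
    rogersBound n ≤ (1 + η) ^ n * (1 + n * Real.log (1 / η)) := by
  refine csInf_le ⟨0, ?_⟩ ⟨η, hη, rfl⟩
  rintro _ ⟨ξ, ⟨h0, h1⟩, rfl⟩
  rcases Nat.eq_zero_or_pos n with rfl | hn
  · simp at h1; linarith
  have h2 : ξ ≤ 1 := h1.le.trans (by
    rw [div_le_one (by positivity)]; exact_mod_cast hn)
  have h3 : 0 ≤ Real.log (1 / ξ) := Real.log_nonneg (by rwa [le_div_iff₀ h0, one_mul])
  change 0 ≤ (1 + ξ) ^ n * (1 + n * Real.log (1 / ξ))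
  positivity

theorem isUniversalCoveringBound_rogersBound {n : ℕ} (hn : 1 ≤ n) :
    IsUniversalCoveringBound n (rogersBound n) := by
  have hn0 : (1 : ℝ) ≤ n := by exact_mod_cast hn
  intro H hH
  have hle : ∀ η ∈ Ioo (0 : ℝ) (1 / n),
      coveringDensity H ≤ ENNReal.ofReal ((1 + η) ^ n * (1 + n * Real.log (1 / η))) :=
    fun η hη => coveringDensity_le_rogers hn hH ⟨hη.1, hη.2.trans_le (by
      rw [div_le_one (by positivity)]; exact hn0)⟩
  have hne : (Ioo (0 : ℝ) (1 / n)).Nonempty := nonempty_Ioo.2 (by positivity)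
  have htop : coveringDensity H ≠ ∞ := by
    obtain ⟨η, hη⟩ := hne
    exact ((hle η hη).trans_lt ENNReal.ofReal_lt_top).ne
  have hpos : 0 ≤ rogersBound n := by
    have := one_add_mul_log_le_rogersBound hn
    have h2 : 0 ≤ Real.log n := Real.log_natCast_nonneg n
    nlinarith
  rw [ENNReal.le_ofReal_iff_toReal_le htop hpos]
  refine le_csInf (hne.image _) ?_
  rintro _ ⟨η, hη, rfl⟩
  refine ENNReal.toReal_le_of_le_ofReal ?_ (hle η hη)
  have h3 : 0 ≤ Real.log (1 / η) := Real.log_nonneg (by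
    rw [le_div_iff₀ hη.1, one_mul]
    exact hη.2.le.trans (by rw [div_le_one (by positivity)]; exact hn0))
  have := hη.1
  positivity

/-- The lower bound uses only `η < 1/n`. For the upper bound take `η = 1/(n log n)`: then `(1 + η)^n
≤ exp (1/log n)` and `log (1/η) = log n + log log n`. -/
theorem tendsto_rogersBound_div :
    Tendsto (fun n : ℕ => rogersBound n / (n * Real.log n)) atTop (nhds 1) := by
  have hlog : Tendsto (fun n : ℕ => Real.log n) atTop atTop :=
    Real.tendsto_log_atTop.comp tendsto_natCast_atTop_atTop
  have hlogdiv : Tendsto (fun x : ℝ => Real.log x / x) atTop (nhds 0) :=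
    Real.isLittleO_log_id_atTop.tendsto_div_nhds_zero
  have hupper : Tendsto (fun n : ℕ => Real.exp (1 / Real.log n) *
      (1 / (n * Real.log n) + 1 + Real.log (Real.log n) / Real.log n)) atTop (nhds 1) := by
    have h1 : Tendsto (fun n : ℕ => Real.exp (1 / Real.log n)) atTop (nhds 1) := by
      rw [← Real.exp_zero]
      exact (Real.continuous_exp.tendsto 0).comp (tendsto_const_nhds.div_atTop hlog)
    have h2 : Tendsto (fun n : ℕ => 1 / (n * Real.log n)) atTop (nhds 0) :=
      tendsto_const_nhds.div_atTop (tendsto_natCast_atTop_atTop.atTop_mul_atTop₀ hlog)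
    have h3 := h1.mul ((h2.add (tendsto_const_nhds (x := (1 : ℝ)))).add (hlogdiv.comp hlog))
    simpa using h3
  refine tendsto_of_tendsto_of_tendsto_of_le_of_le' tendsto_const_nhds hupper ?_ ?_
  · filter_upwards [eventually_ge_atTop 1, hlog.eventually_gt_atTop 0] with n hn hl
    have hn0 : (0 : ℝ) < n := by exact_mod_cast hn
    rw [le_div_iff₀ (by positivity)]
    linarith [one_add_mul_log_le_rogersBound hn]
  · filter_upwards [eventually_ge_atTop 1, hlog.eventually_gt_atTop 1] with n hn hl
    have hn0 : (0 : ℝ) < n := by exact_mod_cast hn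
    have hl0 : 0 < Real.log n := by linarith
    have hη : 1 / (n * Real.log n) ∈ Ioo (0 : ℝ) (1 / n) := by
      refine ⟨by positivity, ?_⟩
      gcongr
      nlinarith
    have h1 := rogersBound_le hη
    have h2 : (1 + 1 / (n * Real.log n)) ^ n ≤ Real.exp (1 / Real.log n) := by
      calc (1 + 1 / (n * Real.log n)) ^ n ≤ Real.exp (1 / (n * Real.log n)) ^ n := by
            gcongr
            linarith [Real.add_one_le_exp (1 / (n * Real.log n))]
        _ = _ := by rw [← Real.exp_nat_mul]; congr 1; field_simp
    rw [one_div_one_div, Real.log_mul hn0.ne' hl0.ne'] at h1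
    have h3 : 0 ≤ Real.log (Real.log n) := Real.log_nonneg hl.le
    rw [div_le_iff₀ (by positivity)]
    calc rogersBound n ≤ _ := h1
      _ ≤ Real.exp (1 / Real.log n) * (1 + n * (Real.log n + Real.log (Real.log n))) := by gcongr
      _ = _ := by field_simp; ring

theorem one_le_rogersBound {n : ℕ} (hn : 1 ≤ n) : 1 ≤ rogersBound n := by
  have h1 := one_add_mul_log_le_rogersBound hn
  have h2 : 0 ≤ n * Real.log n := mul_nonneg (Nat.cast_nonneg _) (Real.log_natCast_nonneg n)
  linarith

theorem isEquivalent_of_eventually_eq_rogersBound {f : ℕ → ℝ}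
    (hf : ∀ n : ℕ, 3 ≤ n → f n = 2 * (1 - 2 / (n : ℝ)) / (Real.exp 1 * n * rogersBound n)) :
    f ~[atTop] fun n : ℕ => 2 / (Real.exp 1 * (n : ℝ) ^ 2 * Real.log n) := by
  refine Asymptotics.isEquivalent_of_tendsto_one ?_
  have h1 : Tendsto (fun n : ℕ => 1 - 2 / (n : ℝ)) atTop (nhds 1) := by
    simpa using (tendsto_const_nhds (x := (1 : ℝ))).sub
      (tendsto_const_nhds.div_atTop tendsto_natCast_atTop_atTop (a := (2 : ℝ)))
  have h2 := h1.mul (tendsto_rogersBound_div.inv₀ one_ne_zero)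
  rw [inv_one, mul_one] at h2
  refine h2.congr' ?_
  filter_upwards [eventually_ge_atTop 3] with n hn
  have hn0 : (1 : ℝ) < n := by exact_mod_cast (by omega : 1 < n)
  have hl : 0 < Real.log n := Real.log_pos hn0
  have hr := one_le_rogersBound (by omega : 1 ≤ n)
  rw [Pi.div_apply, hf n hn]
  have hn1 : (n : ℝ) ≠ 0 := by positivity
  have hr1 : rogersBound n ≠ 0 := by positivity
  field_simp

/-! ### The final form of the constants -/

/-- This weakens the constant `2/(e(n + 2)T)`, since `(1 - 2/n)(n + 2) = n - 4/n ≤ n`. -/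
theorem avgSelfDist_lt_of_three_le {n : ℕ} (hn : 3 ≤ n) {T : ℝ}
    (hT : IsUniversalCoveringBound n T) {E : Type*} [NormedAddCommGroup E] [NormedSpace ℝ E]
    [MeasurableSpace E] [BorelSpace E] (ν : Measure E) [IsProbabilityMeasure ν]
    (hE : Module.finrank ℝ E = n) (hν : ν (Metric.closedBall (0 : E) 1)ᶜ = 0) :
    avgSelfDist ν < 2 * (1 - (2 : ℝ)⁻¹ ^ n *
      (2 * (1 - 2 / (n : ℝ)) / (Real.exp 1 * n * T))) := by
  have hn0 : (0 : ℝ) < n := by exact_mod_cast (by omega : 0 < n)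
  obtain ⟨hT0, hlt⟩ := avgSelfDist_lt_of_isUniversalCoveringBound (by omega) hT ν hE hν
  refine hlt.trans_le ?_
  have key : 2 * (1 - 2 / (n : ℝ)) / (Real.exp 1 * n * T) ≤ 2 / (Real.exp 1 * (n + 2) * T) := by
    rw [div_le_div_iff₀ (by positivity) (by positivity)]
    have h1 : (1 - 2 / (n : ℝ)) * (n + 2) ≤ n := by
      have h2 : (1 - 2 / (n : ℝ)) * (n + 2) = n - 4 / n := by field_simp; ring
      rw [h2]
      linarith [show 0 < 4 / (n : ℝ) by positivity]
    calc 2 * (1 - 2 / (n : ℝ)) * (Real.exp 1 * (n + 2) * T)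
        = 2 * (Real.exp 1 * T) * ((1 - 2 / (n : ℝ)) * (n + 2)) := by ring
      _ ≤ 2 * (Real.exp 1 * T) * n := by gcongr
      _ = _ := by ring
  gcongr

theorem theorem2 :
    (∀ n : ℕ, 3 ≤ n →
      -- Rogers' quantity is a universal bound for translative covering densities
      IsUniversalCoveringBound n (rogersBound n) ∧
      -- the estimate, with Rogers' quantity and with any other universal bound
      ∀ (E : Type*) [NormedAddCommGroup E] [NormedSpace ℝ E] [MeasurableSpace E] [BorelSpace E]
        (ν : Measure E) [IsProbabilityMeasure ν],
        Module.finrank ℝ E = n → ν (Metric.closedBall (0 : E) 1)ᶜ = 0 →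
        avgSelfDist ν < 2 * (1 - (2 : ℝ)⁻¹ ^ n *
          (2 * (1 - 2 / (n : ℝ)) / (Real.exp 1 * n * rogersBound n))) ∧
        ∀ T : ℝ, IsUniversalCoveringBound n T →
          avgSelfDist ν < 2 * (1 - (2 : ℝ)⁻¹ ^ n *
            (2 * (1 - 2 / (n : ℝ)) / (Real.exp 1 * n * T)))) ∧
    ∃ f : ℕ → ℝ,
      (∀ n : ℕ, 2 ≤ n → f n ∈ Ioc (0 : ℝ) 1) ∧
      (∀ n : ℕ, 3 ≤ n →
        f n = 2 * (1 - 2 / (n : ℝ)) / (Real.exp 1 * n * rogersBound n)) ∧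
      (f ~[atTop] fun n : ℕ => 2 / (Real.exp 1 * (n : ℝ) ^ 2 * Real.log n)) ∧
      ∀ n : ℕ, 2 ≤ n →
        ∀ (E : Type*) [NormedAddCommGroup E] [NormedSpace ℝ E] [MeasurableSpace E] [BorelSpace E]
          (ν : Measure E) [IsProbabilityMeasure ν],
          Module.finrank ℝ E = n → ν (Metric.closedBall (0 : E) 1)ᶜ = 0 →
          avgSelfDist ν ≤ 2 * (1 - (2 : ℝ)⁻¹ ^ n * f n) := by

  refine ⟨fun n hn => ⟨isUniversalCoveringBound_rogersBound (by omega), ?_⟩, ?_⟩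
  · intro E _ _ _ _ ν _ hE hν
    exact ⟨avgSelfDist_lt_of_three_le hn (isUniversalCoveringBound_rogersBound (by omega)) ν hE hν,
      fun T hT => avgSelfDist_lt_of_three_le hn hT ν hE hν⟩
  -- The general formula vanishes at `n = 2`, where `f` must be positive; there the stronger
  -- constant with `n + 2` is used.
  · let f : ℕ → ℝ := fun n => if n = 2 then 2 / (Real.exp 1 * ((2 : ℕ) + 2) * rogersBound 2)
      else 2 * (1 - 2 / (n : ℝ)) / (Real.exp 1 * n * rogersBound n)
    have hf2 : f 2 = 2 / (Real.exp 1 * ((2 : ℕ) + 2) * rogersBound 2) := if_pos rfl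
    have hf : ∀ n : ℕ, 3 ≤ n →
        f n = 2 * (1 - 2 / (n : ℝ)) / (Real.exp 1 * n * rogersBound n) :=
      fun n hn => if_neg (by omega)
    have he : 2 ≤ Real.exp 1 := by linarith [Real.add_one_le_exp (1 : ℝ)]
    refine ⟨f, fun n hn => ?_, hf, isEquivalent_of_eventually_eq_rogersBound hf, ?_⟩
    · have hr := one_le_rogersBound (by omega : 1 ≤ n)
      rcases hn.eq_or_lt with rfl | hn
      · rw [hf2]
        refine ⟨by positivity, ?_⟩
        rw [div_le_one (by positivity)]
        push_cast
        nlinarith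
      · rw [hf n hn]
        have hn3 : (3 : ℝ) ≤ n := by exact_mod_cast hn
        have h1 : 2 / (n : ℝ) < 1 := by rw [div_lt_one (by linarith)]; linarith
        have h0 : 0 < 2 / (n : ℝ) := by positivity
        have h2 : 0 < 1 - 2 / (n : ℝ) := by linarith
        refine ⟨by positivity, ?_⟩
        rw [div_le_one (by positivity)]
        have h3 : 1 ≤ n * rogersBound n := by nlinarith
        calc 2 * (1 - 2 / (n : ℝ)) ≤ 2 * 1 := by linarith
          _ ≤ Real.exp 1 * (n * rogersBound n) := by gcongr
          _ = _ := by ring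
    · intro n hn E _ _ _ _ ν _ hE hν
      have hT := isUniversalCoveringBound_rogersBound (by omega : 1 ≤ n)
      rcases hn.eq_or_lt with rfl | hn
      · rw [hf2]
        exact (avgSelfDist_lt_of_isUniversalCoveringBound (by omega) hT ν hE hν).2.le
      · rw [hf n hn]
        exact (avgSelfDist_lt_of_three_le hn hT ν hE hν).le
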